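/- **Setting.** Let $K$ be an irreducible nonnegative real square matrix with rows and columns indexed by a finite set $E$, and let $\rho$ be its Perron root (the largest modulus of an eigenvalue of $K$). Assume $\rho>1$. Let $h$ be the index of imprimitivity of $K$, i.e. the largest integer $h\ge 1$ for which there is a partition of $E$ into nonempty sets $E_1,\dots,E_h$ such that $K_{e,f}\ne 0$ with $e\in E_i$ implies $f\in E_{i+1}$ (indices modulo $h$, so $E_{h+1}=E_1$). Fix such a partition for this $h$, and let $K_j$ be the submatrix of $K$ with rows in $E_j$ and columns in $E_{j+1}$. Let $y_1$ (a row vector) and $z_1$ (a column vector) be real left and right eigenvectors of $K_1K_2\cdots K_h$ for its Perron root, normalized by $y_1z_1=1$. For $j=1,\dots,h$ put $$y_j=\rho^{1-j}\,y_1K_1K_2\cdots K_{j-1},\qquad z_j=\rho^{j-h-1}\,K_jK_{j+1}\cdots K_hz_1 .$$ Let $Z$ be the $|E|\times h$ matrix whose $j$-th column is $z_j$ on $E_j$ and $0$ elsewhere, $Y$ the $h\times|E|$ matrix whose $j$-th row is $y_j$ on $E_j$ and $0$ elsewhere, $P$ the $h\times h$ permutation matrix with $P_{i,j}=1$ if $j\equiv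 i+1 \pmod h$ and $P_{i,j}=0$ otherwise, and $\Theta$ the $h\times h$ circulant matrix with $\Theta_{i,j}=\rho^{(j-i)\bmod h}$, where $(j-i)\bmod h\in\{0,\dots,h-1\}$. **Claim.** For every integer $r$ with $0\le r<h$, $$\lim_{q\to\infty}\frac{\rho^h-1}{\rho^{hq}-1}\sum_{i=0}^{hq+r-1}K^i=\rho^r\,Z\,P^r\,\Theta\,Y .$$ Moreover, this applies to flow matrices. Let $B$ be a connected bipartite graph, possibly with parallel edges, with finite edge set $E$ and with left nodes and right nodes, in which every right node has degree $2$, every left node has degree at least $2$ and some left node has degree at least $3$. For $e\in E$ let $\lambda(e)$ be the left node of $e$ and $\bar e$ the other edge at the right node of $e$, and let $K_{e,f}=1$ if $\lambda(\bar f)=\lambda(e)$ and $\bar f\ne e$, and $K_{e,f}=0$ otherwise. Then $K$ is irreducible and its Perron root is greater than $1$, so the limit formula holds for it. -/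

import Mathlib

open Filter Topology

namespace FlowLimit

noncomputable section

section Perron

variable {n : Type*} [Fintype n] [DecidableEq n]

/-- The largest modulus of a complex eigenvalue of a real square matrix. -/
def perronRoot (A : Matrix n n ℝ) : ℝ :=
  (spectralRadius ℂ (A.map (algebraMap ℝ ℂ))).toReal

/-- `y` (a row vector) and `z` (a column vector) are left and right eigenvectors of `A`
for its Perron root, normalized by `y z = 1`; in particular both are nonzero. -/
structure IsPerronPair (A : Matrix n n ℝ) (y z : n → ℝ) : Prop where
  left_eigen : Matrix.vecMul y A = perronRoot A • y
  right_eigen : A.mulVec z = perronRoot A • z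
  normalized : dotProduct y z = 1

end Perron

section Cyclic

variable {n : Type*}

/-- The classes `E_j = {e | c e = j}`, for `j = 0, …, h - 1`, form a partition of the index set into
`h` nonempty sets, and every nonzero entry of `K` has its row in some `E_j` and its column in the
cyclically next class `E_{j+1}` (with `E_h = E_0`). -/
structure IsCyclicPartition (K : Matrix n n ℝ) {h : ℕ} (c : n → Fin h) : Prop where
  surjective : Function.Surjective c
  step : ∀ e f, K e f ≠ 0 → (c f : ℕ) = ((c e : ℕ) + 1) % h

/-- `h` is the index of imprimitivity: the largest number of classes of a cyclic partition. -/
def IsImprimitivityIndex (K : Matrix n n ℝ) (h : ℕ) : Prop :=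
  IsGreatest {m : ℕ | 0 < m ∧ ∃ c : n → Fin m, IsCyclicPartition K c} h

/-- The elements of the class number `j` (numbering from `0`). -/
abbrev Cls {h : ℕ} (c : n → Fin h) (j : ℕ) : Type _ := {e : n // (c e : ℕ) = j}

/-- The submatrix of `K` with rows in the class `a` and columns in the class `b`. -/
def block (K : Matrix n n ℝ) {h : ℕ} (c : n → Fin h) (a b : ℕ) :
    Matrix (Cls c a) (Cls c b) ℝ :=
  K.submatrix Subtype.val Subtype.val

variable [Fintype n] [DecidableEq n]

/-- With `K_j` the block of `K` with rows in the class `j` and columns in the next class, this is the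
product `K_a K_{a+1} ⋯ K_{a+k-1}` of `k` blocks. The last factor has its columns in the class `b`;
this is used only with `b = a + k`, or with `b = 0` when `a + k = h`. The empty product is the
identity. -/
def blockProd (K : Matrix n n ℝ) {h : ℕ} (c : n → Fin h) (a : ℕ) :
    ℕ → (b : ℕ) → Matrix (Cls c a) (Cls c b) ℝ
  | 0, b => block 1 c a b
  | k + 1, b => blockProd K c a k (a + k) * block K c (a + k) b

/-- The product `K_0 K_1 ⋯ K_{h-1}` of all the blocks, a square matrix on the class `0`. -/
def cycleProd (K : Matrix n n ℝ) {h : ℕ} (c : n → Fin h) : Matrix (Cls c 0) (Cls c 0) ℝ :=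
  blockProd K c 0 h 0

/-- The row vector `y_j = ρ^{-j} y_0 K_0 ⋯ K_{j-1}` on the class `j`. -/
def leftVec (K : Matrix n n ℝ) {h : ℕ} (c : n → Fin h) (y : Cls c 0 → ℝ) (j : ℕ) :
    Cls c j → ℝ :=
  (perronRoot K ^ j)⁻¹ • Matrix.vecMul y (blockProd K c 0 j j)

/-- The column vector `z_j = ρ^{-(h-j)} K_j ⋯ K_{h-1} z_0` on the class `j < h`. -/
def rightVec (K : Matrix n n ℝ) {h : ℕ} (c : n → Fin h) (z : Cls c 0 → ℝ) (j : ℕ) :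
    Cls c j → ℝ :=
  (perronRoot K ^ (h - j))⁻¹ • (blockProd K c j (h - j) 0).mulVec z

/-- The matrix whose column `j` is `z_j` on the class `j` and zero elsewhere. -/
def matZ (K : Matrix n n ℝ) {h : ℕ} (c : n → Fin h) (z : Cls c 0 → ℝ) : Matrix n (Fin h) ℝ :=
  Matrix.of fun e j => if he : (c e : ℕ) = j then rightVec K c z j ⟨e, he⟩ else 0

/-- The matrix whose row `j` is `y_j` on the class `j` and zero elsewhere. -/
def matY (K : Matrix n n ℝ) {h : ℕ} (c : n → Fin h) (y : Cls c 0 → ℝ) : Matrix (Fin h) n ℝ :=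
  Matrix.of fun j e => if he : (c e : ℕ) = j then leftVec K c y j ⟨e, he⟩ else 0

end Cyclic

/-- The circulant matrix with first row `1, ρ, ρ², …, ρ^{h-1}`. -/
def matTheta (ρ : ℝ) (h : ℕ) : Matrix (Fin h) (Fin h) ℝ :=
  Matrix.of fun i j => ρ ^ (((j : ℕ) + (h - (i : ℕ))) % h)

/-- The cyclic permutation matrix: the entry `1` of row `i` is in column `i + 1` modulo `h`. -/
def matP (h : ℕ) : Matrix (Fin h) (Fin h) ℝ :=
  Matrix.of fun i j => if (j : ℕ) = ((i : ℕ) + 1) % h then 1 else 0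

/-- A bipartite graph with edge set `E`, left (bit) nodes `L` and right (check) nodes `R`; parallel
edges are allowed. -/
structure BipartiteGraph (E L R : Type*) where
  left : E → L
  right : E → R

namespace BipartiteGraph

variable {E L R : Type*} (B : BipartiteGraph E L R)

/-- The simple graph on all the nodes in which two nodes are adjacent when an edge joins them. -/
def nodeGraph : SimpleGraph (L ⊕ R) :=
  SimpleGraph.fromRel fun x y => ∃ e, x = Sum.inl (B.left e) ∧ y = Sum.inr (B.right e)

def leftDegree (l : L) : ℕ := Nat.card {e : E // B.left e = l}

def rightDegree (r : R) : ℕ := Nat.card {e : E // B.right e = r}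

/-- `g` is an edge other than `f` with the same right node; if all right degrees are `2`, then each
`f` has exactly one such `g`, its conjugate. -/
def IsConj (f g : E) : Prop := g ≠ f ∧ B.right g = B.right f

open Classical in
/-- The flow matrix: the entry at `(e, f)` is `1` if the conjugate of `f` is different from `e` and
has the same left node as `e`, and `0` otherwise. -/
def flowMatrix : Matrix E E ℝ :=
  Matrix.of fun e f => if ∃ g, B.IsConj f g ∧ B.left g = B.left e ∧ g ≠ e then 1 else 0

end BipartiteGraph

end

end FlowLimit

/-! Write ρ for the Perron root. A power of `K` with exponent divisible by `h` preserves classes,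
and on class 0 the power `K ^ h` acts as `cycleProd`. Since `h` is the gcd of the closed walk
lengths, `cycleProd` is primitive; a positive eigenvector of `K`, restricted to class 0, shows that
its Perron root is ρ^h. Hence ρ^(-hm) times its m-th power tends to the rank-one matrix z y
(`tendsto_cycleProd_pow`).

A long walk from e to f consists of a path to class 0, a number of full circuits and a path from
class 0 to f. This transfers the limit to all of `K`: ρ^(-i) K^i − Z P^i Y tends to 0
(`tendsto_pow_sub`). The model terms ρ^i Z P^i Y are multiplied by ρ^h when i grows by h, so their
sums are geometric, and the error is negligible against ∑ ρ^i (`tendsto_scaled_sum_of_asymptotic`).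
One period of model terms gives the limit, because Θ = ∑ ρ^s P^s (`matTheta_eq_sum`).

For a flow matrix, the right nodes of degree 2 are edges of a graph on the left nodes, the elements
of `E` are its directed edges, and `K` describes non-backtracking steps. The uniform random choice
of a step is doubly stochastic, so reachability is symmetric (`reflTransGen_step_symm`). A left node
of degree at least 3 lets a walk turn round, and connectedness spreads this to all edges. Column
sums that are at least 1, and not all equal to 1, force ρ > 1. -/

namespace FlowLimit

open Matrix

/-! ### Perron–Frobenius theory for irreducible matrices -/

section PerronFrobenius

variable {n : Type*} [Fintype n]

theorem mulVec_nonneg {A : Matrix n n ℝ} (hA : ∀ i j, 0 ≤ A i j) {v : n → ℝ} (hv : 0 ≤ v) :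
    0 ≤ A *ᵥ v := fun i ↦
  Finset.sum_nonneg fun j _ ↦ mul_nonneg (hA i j) (hv j)

theorem mulVec_mono {A : Matrix n n ℝ} (hA : ∀ i j, 0 ≤ A i j) {v w : n → ℝ} (h : v ≤ w) :
    A *ᵥ v ≤ A *ᵥ w := fun i ↦
  Finset.sum_le_sum fun j _ ↦ mul_le_mul_of_nonneg_left (h j) (hA i j)

theorem mulVec_pos {A : Matrix n n ℝ} (hA : ∀ i j, 0 < A i j) {v : n → ℝ} (hv : 0 ≤ v)
    (hv0 : v ≠ 0) (i : n) : 0 < (A *ᵥ v) i := by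
  obtain ⟨j, hj⟩ := Function.ne_iff.mp hv0
  exact Finset.sum_pos' (fun k _ ↦ mul_nonneg (hA i k).le (hv k))
    ⟨j, Finset.mem_univ j, mul_pos (hA i j) ((hv j).lt_of_ne' hj)⟩

theorem norm_eigenvector_subinvariant {A : Matrix n n ℝ} (hA : ∀ i j, 0 ≤ A i j) {μ : ℂ}
    {v : n → ℂ} (h : A.map (algebraMap ℝ ℂ) *ᵥ v = μ • v) :
    ‖μ‖ • (fun i ↦ ‖v i‖) ≤ A *ᵥ fun i ↦ ‖v i‖ := by
  intro i
  have hi := congrArg norm (congrFun h i)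
  simp only [Pi.smul_apply, smul_eq_mul, norm_mul] at hi ⊢
  rw [← hi]
  refine (norm_sum_le _ _).trans (Finset.sum_le_sum fun j _ ↦ ?_)
  simp [abs_of_nonneg (hA i j)]

variable [DecidableEq n]

theorem pow_mulVec_eq {A : Matrix n n ℝ} {w : n → ℝ} {μ : ℝ} (h : A *ᵥ w = μ • w) (k : ℕ) :
    (A ^ k) *ᵥ w = μ ^ k • w := by
  induction k with
  | zero => simp
  | succ k ih => rw [pow_succ, ← mulVec_mulVec, h, mulVec_smul, ih, smul_smul, pow_succ']

theorem vecMul_pow_eq {A : Matrix n n ℝ} {w : n → ℝ} {μ : ℝ} (h : w ᵥ* A = μ • w) (k : ℕ) :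
    w ᵥ* (A ^ k) = μ ^ k • w := by
  induction k with
  | zero => simp
  | succ k ih => rw [pow_succ, ← vecMul_vecMul, ih, smul_vecMul, h, smul_smul, pow_succ]

attribute [local instance] Matrix.linftyOpNormedRing Matrix.linftyOpNormedAlgebra

theorem spectralRadius_ne_top [Nonempty n] (A : Matrix n n ℂ) : spectralRadius ℂ A ≠ ⊤ := by
  refine ne_top_of_le_ne_top ?_ (spectrum.spectralRadius_le_nnnorm A)
  exact ENNReal.coe_ne_top

theorem exists_eigenvector_norm_eq_perronRoot [Nonempty n] (A : Matrix n n ℝ) :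
    ∃ (μ : ℂ) (v : n → ℂ), v ≠ 0 ∧ ‖μ‖ = perronRoot A ∧
      A.map (algebraMap ℝ ℂ) *ᵥ v = μ • v := by
  obtain ⟨μ, hμ, hμ'⟩ := spectrum.exists_nnnorm_eq_spectralRadius_of_nonempty
    (spectrum.nonempty_of_isAlgClosed_of_finiteDimensional ℂ (A.map (algebraMap ℝ ℂ)))
  have hμ2 := hμ
  rw [← Matrix.spectrum_toLin', ← Module.End.hasEigenvalue_iff_mem_spectrum] at hμ2
  obtain ⟨v, hv⟩ := hμ2.exists_hasEigenvector
  refine ⟨μ, v, hv.2, ?_, ?_⟩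
  · rw [perronRoot, ← hμ']; simp
  · simpa using hv.apply_eq_smul

/-- A nonnegative nonzero subinvariant vector bounds the Perron root from below. -/
theorem le_perronRoot_of_smul_le [Nonempty n] {A : Matrix n n ℝ} (hA : ∀ i j, 0 ≤ A i j)
    {w : n → ℝ} (hw : 0 ≤ w) (hw0 : w ≠ 0) {r : ℝ} (hr : 0 ≤ r) (h : r • w ≤ A *ᵥ w) :
    r ≤ perronRoot A := by
  have hpow : ∀ k : ℕ, r ^ k • w ≤ (A ^ k) *ᵥ w := by
    intro k
    induction k with
    | zero => simp
    | succ k ih =>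
      rw [pow_succ, pow_succ' A, ← mulVec_mulVec, mul_smul, smul_comm]
      calc r • r ^ k • w = r ^ k • (r • w) := smul_comm _ _ _
        _ ≤ r ^ k • (A *ᵥ w) := smul_le_smul_of_nonneg_left h (pow_nonneg hr k)
        _ = A *ᵥ (r ^ k • w) := (mulVec_smul _ _ _).symm
        _ ≤ _ := mulVec_mono hA ih
  -- Compare at a largest coordinate of `w`, which is also the sup norm of `w` and so cancels.
  -- Gelfand's formula then turns these bounds into one on the spectral radius.
  have hnorm : ∀ k : ℕ, r ^ k ≤ ‖(A.map (algebraMap ℝ ℂ)) ^ k‖ := by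
    intro k
    obtain ⟨i, hi⟩ := Finite.exists_max w
    have hwi : 0 < w i := by
      by_contra hcon
      exact hw0 (funext fun j ↦ le_antisymm ((hi j).trans (not_lt.mp hcon)) (hw j))
    set v : n → ℂ := fun j ↦ (w j : ℂ)
    have hv : ‖v‖ ≤ w i := by
      rw [pi_norm_le_iff_of_nonneg hwi.le]
      intro j
      simpa [v, abs_of_nonneg (hw j)] using hi j
    have hmap : (A.map (algebraMap ℝ ℂ)) ^ k = (A ^ k).map (algebraMap ℝ ℂ) :=
      (Matrix.map_pow A (algebraMap ℝ ℂ) k).symm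
    have h1 : (((A.map (algebraMap ℝ ℂ)) ^ k) *ᵥ v) i = (((A ^ k) *ᵥ w) i : ℂ) := by
      rw [hmap]
      simp [mulVec, dotProduct, v]
    have h2 : r ^ k * w i ≤ ‖(A.map (algebraMap ℝ ℂ)) ^ k‖ * w i :=
      calc r ^ k * w i ≤ ((A ^ k) *ᵥ w) i := hpow k i
        _ ≤ ‖(((A.map (algebraMap ℝ ℂ)) ^ k) *ᵥ v) i‖ := by
            rw [h1, Complex.norm_real]; exact le_abs_self _
        _ ≤ ‖((A.map (algebraMap ℝ ℂ)) ^ k) *ᵥ v‖ := norm_le_pi_norm _ i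
        _ ≤ ‖(A.map (algebraMap ℝ ℂ)) ^ k‖ * ‖v‖ := Matrix.linfty_opNorm_mulVec _ _
        _ ≤ _ := by gcongr
    exact le_of_mul_le_mul_right h2 hwi
  have hlim := spectrum.pow_norm_pow_one_div_tendsto_nhds_spectralRadius (A.map (algebraMap ℝ ℂ))
  have hge : ENNReal.ofReal r ≤ spectralRadius ℂ (A.map (algebraMap ℝ ℂ)) := by
    refine ge_of_tendsto hlim ?_
    filter_upwards [eventually_gt_atTop 0] with k hk
    refine ENNReal.ofReal_le_ofReal ?_
    calc r = (r ^ k) ^ (1 / k : ℝ) := by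
          rw [one_div, Real.pow_rpow_inv_natCast hr hk.ne']
      _ ≤ _ := Real.rpow_le_rpow (pow_nonneg hr k) (hnorm k) (by positivity)
  exact (ENNReal.ofReal_le_iff_le_toReal (spectralRadius_ne_top _)).mp hge

/-- The eigenvalue of a positive eigenvector of a nonnegative matrix is the Perron root. -/
theorem perronRoot_eq_of_pos_eigenvector [Nonempty n] {A : Matrix n n ℝ}
    (hA : ∀ i j, 0 ≤ A i j) {w : n → ℝ} (hw : ∀ i, 0 < w i) {μ : ℝ} (h : A *ᵥ w = μ • w) :
    perronRoot A = μ := by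
  have hμ : 0 ≤ μ := by
    obtain ⟨i⟩ := ‹Nonempty n›
    have h1 := mulVec_nonneg hA (fun j ↦ (hw j).le : 0 ≤ w) i
    rw [h] at h1
    exact nonneg_of_mul_nonneg_left h1 (hw i)
  refine le_antisymm ?_ (le_perronRoot_of_smul_le hA (fun i ↦ (hw i).le) ?_ hμ h.ge)
  · obtain ⟨ν, v, hv0, hν, hv⟩ := exists_eigenvector_norm_eq_perronRoot A
    have hsub := norm_eigenvector_subinvariant hA hv
    rw [← hν]
    -- The smallest multiple of `w` dominating |v| touches it at `i`; the eigenvalues are compared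
    -- in that coordinate.
    obtain ⟨i, hi⟩ := Finite.exists_max fun j ↦ ‖v j‖ / w j
    have hvi : 0 < ‖v i‖ := by
      obtain ⟨j, hj⟩ := Function.ne_iff.mp hv0
      have : 0 < ‖v i‖ / w i := (div_pos (norm_pos_iff.mpr hj) (hw j)).trans_le (hi j)
      exact (div_pos_iff_of_pos_right (hw i)).mp this
    have hle : (fun j ↦ ‖v j‖) ≤ (‖v i‖ / w i) • w := fun j ↦ by
      simpa [div_le_iff₀ (hw j)] using hi j
    have h2 := (hsub i).trans (mulVec_mono hA hle i)
    rw [mulVec_smul, h] at h2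
    simp only [Pi.smul_apply, smul_eq_mul] at h2
    have h3 : ‖v i‖ / w i * (μ * w i) = μ * ‖v i‖ := by field_simp [(hw i).ne']
    rw [h3] at h2
    exact le_of_mul_le_mul_right h2 hvi
  · obtain ⟨i⟩ := ‹Nonempty n›
    exact fun h0 ↦ (hw i).ne' (congrFun h0 i)

/-- Finitely many powers of an irreducible matrix add up to a positive matrix. -/
theorem exists_sum_pow_pos {A : Matrix n n ℝ} (hA : A.IsIrreducible) :
    ∃ N : ℕ, ∀ i j, 0 < (∑ k ∈ Finset.range N, A ^ k) i j := by
  choose k _ hk using (isIrreducible_iff_exists_pow_pos hA.nonneg).mp hA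
  refine ⟨(Finset.univ.sup fun p : n × n ↦ k p.1 p.2) + 1, fun i j ↦ ?_⟩
  rw [Matrix.sum_apply]
  refine Finset.sum_pos' (fun m _ ↦ pow_apply_nonneg hA.nonneg m i j) ⟨k i j, ?_, hk i j⟩
  rw [Finset.mem_range, Nat.lt_succ_iff]
  exact Finset.le_sup (f := fun p : n × n ↦ k p.1 p.2) (Finset.mem_univ (i, j))

/-- Wielandt's argument: let u be the entrywise modulus of an eigenvector whose eigenvalue has
maximal modulus. If ρ u ≤ A u were not an equality, applying the positive matrix `S`, which commutes
with `A`, would make it strict in every coordinate. Then S u would be subinvariant for a number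
larger than ρ, which `le_perronRoot_of_smul_le` excludes. -/
theorem exists_pos_eigenvector [Nonempty n] {A : Matrix n n ℝ} (hA : A.IsIrreducible) :
    ∃ w : n → ℝ, (∀ i, 0 < w i) ∧ A *ᵥ w = perronRoot A • w := by
  obtain ⟨μ, v, hv0, hμ, hv⟩ := exists_eigenvector_norm_eq_perronRoot A
  obtain ⟨N, hN⟩ := exists_sum_pow_pos hA
  set S := ∑ k ∈ Finset.range N, A ^ k
  have hcomm : A * S = S * A := by
    simp only [S, Finset.mul_sum, Finset.sum_mul, ← pow_succ, ← pow_succ']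
  set u : n → ℝ := fun i ↦ ‖v i‖
  have hu : 0 ≤ u := fun i ↦ norm_nonneg _
  have hu0 : u ≠ 0 := fun h ↦ hv0 (funext fun i ↦ norm_eq_zero.mp (congrFun h i))
  have hsub : perronRoot A • u ≤ A *ᵥ u := hμ ▸ norm_eigenvector_subinvariant hA.nonneg hv
  have hSu : ∀ i, 0 < (S *ᵥ u) i := mulVec_pos hN hu hu0
  have heq : A *ᵥ u = perronRoot A • u := by
    by_contra hne
    have hpos := mulVec_pos hN (sub_nonneg.mpr hsub) (sub_ne_zero.mpr hne)
    have hstrict : ∀ i, perronRoot A * (S *ᵥ u) i < (A *ᵥ (S *ᵥ u)) i := by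
      intro i
      have := hpos i
      rw [mulVec_sub, mulVec_smul, mulVec_mulVec, ← hcomm, ← mulVec_mulVec] at this
      simpa using this
    obtain ⟨i, hi⟩ := Finite.exists_min fun j ↦ (A *ᵥ (S *ᵥ u)) j / (S *ᵥ u) j
    have hlt : perronRoot A < (A *ᵥ (S *ᵥ u)) i / (S *ᵥ u) i :=
      (lt_div_iff₀ (hSu i)).mpr (hstrict i)
    refine hlt.not_ge (le_perronRoot_of_smul_le hA.nonneg (fun j ↦ (hSu j).le)
      (fun h0 ↦ (hSu i).ne' (congrFun h0 i)) ((ENNReal.toReal_nonneg).trans hlt.le) fun j ↦ ?_)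
    simpa [le_div_iff₀ (hSu j)] using hi j
  refine ⟨S *ᵥ u, hSu, ?_⟩
  rw [mulVec_mulVec, hcomm, ← mulVec_mulVec, heq, mulVec_smul]

end PerronFrobenius

/-! ### Convergence of the scaled powers of a primitive matrix -/

section PrimitiveLimit

variable {n : Type*} [Fintype n]

/-- The weights of this ℓ¹ norm on rows form a right eigenvector, so moving `C` from the row to the
weights yields the factor θ. -/
theorem sum_abs_vecMul_le {C : Matrix n n ℝ} (hC : ∀ i j, 0 ≤ C i j) {w : n → ℝ}
    (hw : ∀ i, 0 < w i) {θ : ℝ} (h : C *ᵥ w = θ • w) (x : n → ℝ) :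
    ∑ j, |(x ᵥ* C) j| * w j ≤ θ * ∑ i, |x i| * w i := by
  calc ∑ j, |(x ᵥ* C) j| * w j ≤ ∑ j, (∑ i, |x i| * C i j) * w j := by
        refine Finset.sum_le_sum fun j _ ↦ mul_le_mul_of_nonneg_right ?_ (hw j).le
        refine (Finset.abs_sum_le_sum_abs _ _).trans (Finset.sum_le_sum fun i _ ↦ ?_)
        rw [abs_mul, abs_of_nonneg (hC i j)]
    _ = ∑ i, |x i| * (C *ᵥ w) i := by
        simp only [mulVec, dotProduct, Finset.sum_mul, Finset.mul_sum]
        rw [Finset.sum_comm]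
        simp only [mul_assoc]
    _ = θ * ∑ i, |x i| * w i := by
        rw [h, Finset.mul_sum]
        exact Finset.sum_congr rfl fun i _ ↦ by simp only [Pi.smul_apply, smul_eq_mul]; ring

variable [DecidableEq n]

/-- The rows orthogonal to the positive fixed vector of a primitive matrix are contracted to `0`. -/
theorem tendsto_vecMul_pow_zero {B : Matrix n n ℝ} (hB : ∀ i j, 0 ≤ B i j) {w : n → ℝ}
    (hw : ∀ i, 0 < w i) (hBw : B *ᵥ w = w) {N : ℕ} (hN : 0 < N) (hpos : ∀ i j, 0 < (B ^ N) i j)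
    {x : n → ℝ} (hx : x ⬝ᵥ w = 0) : Tendsto (fun m ↦ x ᵥ* (B ^ m)) atTop (𝓝 0) := by
  cases isEmpty_or_nonempty n with
  | inl _ => exact tendsto_pi_nhds.mpr fun i ↦ isEmptyElim i
  | inr _ =>
  have hfix : ∀ k, (B ^ k) *ᵥ w = w := fun k ↦ by
    simpa using pow_mulVec_eq (μ := 1) (by simpa using hBw) k
  -- Doeblin minorization: δ is the largest number for which every column of `B ^ N` dominates δ w.
  -- Subtracting δ w from each column does not affect rows orthogonal to `w`, but lowers the
  -- eigenvalue of `w` from 1 to θ < 1.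
  obtain ⟨p, hp⟩ := Finite.exists_min fun p : n × n ↦ (B ^ N) p.1 p.2 / w p.1
  set δ := (B ^ N) p.1 p.2 / w p.1
  have hδ : 0 < δ := div_pos (hpos _ _) (hw _)
  set C : Matrix n n ℝ := of fun i j ↦ (B ^ N) i j - δ * w i
  have hC : ∀ i j, 0 ≤ C i j := fun i j ↦ sub_nonneg.mpr ((le_div_iff₀ (hw i)).mp (hp (i, j)))
  set θ := 1 - δ * ∑ j, w j
  have hCw : C *ᵥ w = θ • w := by
    ext i
    have h1 := congrFun (hfix N) i
    simp only [mulVec, dotProduct] at h1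
    simp only [mulVec, dotProduct, C, of_apply, sub_mul, Finset.sum_sub_distrib, h1,
      Pi.smul_apply, smul_eq_mul, θ, mul_assoc, ← Finset.mul_sum]
    ring
  have hθ0 : 0 ≤ θ := by
    have := mulVec_nonneg hC (fun i ↦ (hw i).le : 0 ≤ w) p.1
    rw [hCw] at this
    exact nonneg_of_mul_nonneg_left this (hw p.1)
  have hθ1 : θ < 1 := sub_lt_self _ (mul_pos hδ (Finset.sum_pos (fun i _ ↦ hw i)
    Finset.univ_nonempty))
  have hxC : ∀ x : n → ℝ, x ⬝ᵥ w = 0 → x ᵥ* C = x ᵥ* (B ^ N) := by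
    intro x hx
    ext j
    simp only [vecMul, dotProduct, C, of_apply, mul_sub, Finset.sum_sub_distrib] at hx ⊢
    rw [sub_eq_self]
    calc ∑ i, x i * (δ * w i) = δ * ∑ i, x i * w i := by
          rw [Finset.mul_sum]; exact Finset.sum_congr rfl fun i _ ↦ by ring
      _ = 0 := by rw [hx, mul_zero]
  have hgeom : ∀ k, ∑ j, |(x ᵥ* ((B ^ N) ^ k)) j| * w j ≤ θ ^ k * ∑ i, |x i| * w i := by
    intro k
    induction k with
    | zero => simp
    | succ k ih =>
      rw [pow_succ, ← vecMul_vecMul, ← hxC _ (by rw [← dotProduct_mulVec, ← pow_mul, hfix, hx])]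
      refine (sum_abs_vecMul_le hC hw hCw _).trans ?_
      rw [pow_succ', mul_assoc]
      exact mul_le_mul_of_nonneg_left ih hθ0
  -- The remaining m % N steps do not increase the norm, since `B` fixes `w`.
  have hall : ∀ m, ∑ j, |(x ᵥ* (B ^ m)) j| * w j ≤ θ ^ (m / N) * ∑ i, |x i| * w i := by
    intro m
    have hm : B ^ m = (B ^ N) ^ (m / N) * B ^ (m % N) := by
      rw [← pow_mul, ← pow_add, Nat.div_add_mod]
    rw [hm, ← vecMul_vecMul]
    refine (sum_abs_vecMul_le (pow_apply_nonneg hB _) hw (θ := 1) ?_ _).trans ?_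
    · rw [one_smul, hfix]
    · rw [one_mul]; exact hgeom _
  refine tendsto_pi_nhds.mpr fun j ↦ ?_
  have hlim : Tendsto (fun m ↦ (θ ^ (m / N) * ∑ i, |x i| * w i) / w j) atTop (𝓝 0) := by
    have h1 := (tendsto_pow_atTop_nhds_zero_of_lt_one hθ0 hθ1).comp
      (Nat.tendsto_div_const_atTop hN.ne')
    simpa using (h1.mul_const (∑ i, |x i| * w i)).div_const (w j)
  refine squeeze_zero_norm (fun m ↦ ?_) hlim
  rw [le_div_iff₀ (hw j), Real.norm_eq_abs]
  refine le_trans ?_ (hall m)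
  exact Finset.single_le_sum (f := fun j ↦ |(x ᵥ* (B ^ m)) j| * w j)
    (fun k _ ↦ mul_nonneg (abs_nonneg _) (hw k).le) (Finset.mem_univ j)

/-- The powers of a primitive matrix with a positive fixed vector converge to the projection
onto the fixed vectors. -/
theorem tendsto_pow_of_fixed {B : Matrix n n ℝ} (hB : ∀ i j, 0 ≤ B i j) {w : n → ℝ}
    (hw : ∀ i, 0 < w i) (hBw : B *ᵥ w = w) {N : ℕ} (hN : 0 < N) (hpos : ∀ i j, 0 < (B ^ N) i j)
    {y z : n → ℝ} (hy : y ᵥ* B = y) (hz : B *ᵥ z = z) (hyz : y ⬝ᵥ z = 1) (i j : n) :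
    Tendsto (fun m ↦ (B ^ m) i j) atTop (𝓝 (z i * y j)) := by
  have hyp : ∀ k, y ᵥ* (B ^ k) = y := fun k ↦ by
    simpa using vecMul_pow_eq (μ := 1) (by simpa using hy) k
  have hzp : ∀ k, (B ^ k) *ᵥ z = z := fun k ↦ by
    simpa using pow_mulVec_eq (μ := 1) (by simpa using hz) k
  -- No signs are assumed for `y` and `z`. If `y` were orthogonal to `w`, the constant sequence y
  -- B^m would tend to 0.
  have hyw : y ⬝ᵥ w ≠ 0 := by
    intro h0
    have h1 := tendsto_vecMul_pow_zero hB hw hBw hN hpos h0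
    simp only [hyp] at h1
    have h2 : y = 0 := tendsto_nhds_unique tendsto_const_nhds h1
    simp [h2] at hyz
  -- A row orthogonal to `w` is contracted to 0, while its pairing with the fixed vector `z` stays
  -- constant; so it is orthogonal to `z` too.
  have hzw : ∀ k, z k * (y ⬝ᵥ w) = w k := by
    intro k
    have hx : ((y ⬝ᵥ w) • Pi.single k 1 - w k • y) ⬝ᵥ w = 0 := by
      simp [sub_dotProduct, smul_dotProduct, mul_comm]
    have h1 := tendsto_vecMul_pow_zero hB hw hBw hN hpos hx
    have h2 : Tendsto (fun m ↦ (((y ⬝ᵥ w) • Pi.single k 1 - w k • y) ᵥ* (B ^ m)) ⬝ᵥ z)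
        atTop (𝓝 (0 ⬝ᵥ z)) :=
      tendsto_finsetSum _ fun l _ ↦ (tendsto_pi_nhds.mp h1 l).mul_const _
    simp only [← dotProduct_mulVec, hzp] at h2
    have h3 := tendsto_nhds_unique tendsto_const_nhds h2
    simp only [sub_dotProduct, smul_dotProduct, hyz, single_one_dotProduct, zero_dotProduct,
      smul_eq_mul] at h3
    linarith
  have hx : (Pi.single i 1 - z i • y) ⬝ᵥ w = 0 := by
    simp [sub_dotProduct, smul_dotProduct, hzw]
  have h1 := tendsto_pi_nhds.mp (tendsto_vecMul_pow_zero hB hw hBw hN hpos hx) j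
  simp only [sub_vecMul, smul_vecMul, hyp, single_one_vecMul, Pi.sub_apply, Pi.smul_apply,
    smul_eq_mul, Pi.zero_apply, row_apply] at h1
  exact tendsto_sub_nhds_zero_iff.mp h1

/-- The powers of a primitive matrix, scaled by its Perron root, converge to the product of a
normalized pair of eigenvectors. -/
theorem IsPerronPair.tendsto_pow {A : Matrix n n ℝ} (hA : ∀ i j, 0 ≤ A i j) {w : n → ℝ}
    (hw : ∀ i, 0 < w i) (hAw : A *ᵥ w = perronRoot A • w) (hρ : 0 < perronRoot A) {N : ℕ}
    (hN : 0 < N) (hpos : ∀ i j, 0 < (A ^ N) i j) {y z : n → ℝ} (hyz : IsPerronPair A y z)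
    (i j : n) :
    Tendsto (fun m ↦ (perronRoot A ^ m)⁻¹ * (A ^ m) i j) atTop (𝓝 (z i * y j)) := by
  have h := tendsto_pow_of_fixed (B := (perronRoot A)⁻¹ • A)
    (fun i j ↦ mul_nonneg (inv_nonneg.mpr hρ.le) (hA i j)) hw
    (by rw [smul_mulVec, hAw, smul_smul, inv_mul_cancel₀ hρ.ne', one_smul]) hN
    (fun i j ↦ by
      rw [smul_pow, Matrix.smul_apply, smul_eq_mul]
      exact mul_pos (pow_pos (inv_pos.mpr hρ) _) (hpos i j))
    (y := y) (z := z)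
    (by rw [vecMul_smul, hyz.left_eigen, smul_smul, inv_mul_cancel₀ hρ.ne', one_smul])
    (by rw [smul_mulVec, hyz.right_eigen, smul_smul, inv_mul_cancel₀ hρ.ne', one_smul])
    hyz.normalized i j
  simpa [smul_pow, inv_pow] using h

end PrimitiveLimit

/-! ### Cyclic classes, return times and the primitive block product -/

section Cyclic

theorem nonempty_cls {n : Type*} {K : Matrix n n ℝ} {h : ℕ} {c : n → Fin h} (hc : IsCyclicPartition K c)
    (hh : 0 < h) : Nonempty (Cls c 0) := by
  obtain ⟨e, he⟩ := hc.surjective ⟨0, hh⟩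
  exact ⟨⟨e, by rw [he]⟩⟩

theorem sum_cls_eq {n : Type*} [Fintype n] {h : ℕ} (c : n → Fin h) {a : ℕ} {F : n → ℝ}
    (hF : ∀ g, F g ≠ 0 → (c g : ℕ) = a) : ∑ g : Cls c a, F g = ∑ g, F g := by
  rw [← Finset.sum_subtype (Finset.univ.filter fun g ↦ (c g : ℕ) = a) (by simp) F]
  exact Finset.sum_filter_of_ne fun g _ hg ↦ hF g hg

variable {n : Type*} [Fintype n] [DecidableEq n]

theorem pow_add_apply_pos {K : Matrix n n ℝ} (hK : ∀ i j, 0 ≤ K i j) {a b : ℕ} {e f g : n}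
    (h1 : 0 < (K ^ a) e f) (h2 : 0 < (K ^ b) f g) : 0 < (K ^ (a + b)) e g := by
  rw [pow_add, mul_apply]
  exact Finset.sum_pos' (fun k _ ↦ mul_nonneg (pow_apply_nonneg hK a e k)
    (pow_apply_nonneg hK b k g)) ⟨f, Finset.mem_univ f, mul_pos h1 h2⟩

theorem IsCyclicPartition.class_of_pow_ne_zero {K : Matrix n n ℝ} {h : ℕ} {c : n → Fin h}
    (hc : IsCyclicPartition K c) (k : ℕ) {e f : n} (hef : (K ^ k) e f ≠ 0) :
    (c f : ℕ) = (c e + k) % h := by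
  induction k generalizing f with
  | zero =>
    rw [pow_zero, one_apply] at hef
    rw [add_zero, Nat.mod_eq_of_lt (c e).2]
    by_contra hne
    exact hef (if_neg fun h ↦ hne (by rw [h]))
  | succ k ih =>
    rw [pow_succ, mul_apply] at hef
    obtain ⟨g, _, hg⟩ := Finset.exists_ne_zero_of_sum_ne_zero hef
    rw [hc.step g f (right_ne_zero_of_mul hg), ih (left_ne_zero_of_mul hg), Nat.mod_add_mod,
      add_assoc]

/-- The numbers of steps in which a closed walk can return to its starting point. -/
def returnTimes (K : Matrix n n ℝ) (e : n) : Set ℕ := {k | 0 < (K ^ k) e e}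

theorem setGcd_returnTimes_pos {K : Matrix n n ℝ} (hK : K.IsIrreducible) (e : n) :
    0 < Nat.setGcd (returnTimes K e) := by
  obtain ⟨k, hk, hk'⟩ := (isIrreducible_iff_exists_pow_pos hK.nonneg).mp hK e e
  exact Nat.pos_of_dvd_of_pos (Nat.setGcd_dvd_of_mem (s := returnTimes K e) hk') hk

theorem pow_mul_mem_returnTimes {K : Matrix n n ℝ} (hK : ∀ i j, 0 ≤ K i j) {e : n} {k : ℕ}
    (hk : k ∈ returnTimes K e) (m : ℕ) : k * m ∈ returnTimes K e := by
  induction m with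
  | zero => simp [returnTimes]
  | succ m ih => exact pow_add_apply_pos hK ih hk

/-- The class of f is the length of any walk from `e` to f modulo the gcd d. It is well defined
because closing two such walks by the same return path gives two lengths divisible by d. -/
theorem exists_isCyclicPartition_setGcd {K : Matrix n n ℝ} (hK : K.IsIrreducible) (e : n) :
    ∃ c : n → Fin (Nat.setGcd (returnTimes K e)), IsCyclicPartition K c := by
  have hconn := (isIrreducible_iff_exists_pow_pos hK.nonneg).mp hK
  set d := Nat.setGcd (returnTimes K e)
  have hd : 0 < d := setGcd_returnTimes_pos hK e
  have key : ∀ {a b : ℕ} {f : n}, 0 < (K ^ a) e f → 0 < (K ^ b) e f → a % d = b % d := by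
    intro a b f ha hb
    obtain ⟨l, _, hl⟩ := hconn f e
    have h1 : d ∣ a + l := Nat.setGcd_dvd_of_mem (s := returnTimes K e)
      (pow_add_apply_pos hK.nonneg ha hl)
    have h2 : d ∣ b + l := Nat.setGcd_dvd_of_mem (s := returnTimes K e)
      (pow_add_apply_pos hK.nonneg hb hl)
    have h3 : a + l ≡ b + l [MOD d] :=
      ((Nat.modEq_zero_iff_dvd).mpr h1).trans ((Nat.modEq_zero_iff_dvd).mpr h2).symm
    exact Nat.ModEq.add_right_cancel' l h3
  choose k _ hk using hconn e
  refine ⟨fun f ↦ ⟨k f % d, Nat.mod_lt _ hd⟩, fun j ↦ ?_, fun f g hfg ↦ ?_⟩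
  · obtain ⟨l, hl, hl'⟩ := hconn e e
    -- A closed walk of length at least j passes through class j after j steps.
    have hlj : 0 < (K ^ (l * (j : ℕ))) e e := pow_mul_mem_returnTimes hK.nonneg hl' j
    have hle : (j : ℕ) ≤ l * j := Nat.le_mul_of_pos_left _ hl
    rw [← Nat.add_sub_cancel' hle, pow_add, mul_apply] at hlj
    obtain ⟨f, _, hf⟩ := Finset.exists_ne_zero_of_sum_ne_zero hlj.ne'
    have hf' : 0 < (K ^ (j : ℕ)) e f :=
      (pow_apply_nonneg hK.nonneg _ e f).lt_of_ne' (left_ne_zero_of_mul hf)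
    refine ⟨f, Fin.ext ?_⟩
    change k f % d = j
    rw [key (hk f) hf', Nat.mod_eq_of_lt j.2]
  · have h1 : 0 < (K ^ 1) f g := by
      rw [pow_one]; exact (hK.nonneg f g).lt_of_ne' hfg
    change k g % d = (k f % d + 1) % d
    rw [Nat.mod_add_mod, key (hk g) (pow_add_apply_pos hK.nonneg (hk f) h1)]

/-- The index of imprimitivity is the greatest common divisor of the return times. -/
theorem IsImprimitivityIndex.eq_setGcd {K : Matrix n n ℝ} (hK : K.IsIrreducible) {h : ℕ}
    (hh : IsImprimitivityIndex K h) (e : n) : Nat.setGcd (returnTimes K e) = h := by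
  refine le_antisymm (hh.2 ⟨setGcd_returnTimes_pos hK e, exists_isCyclicPartition_setGcd hK e⟩) ?_
  obtain ⟨-, c, hc⟩ := hh.1
  refine Nat.le_of_dvd (setGcd_returnTimes_pos hK e) (Nat.dvd_setGcd_iff.mpr fun k hk ↦ ?_)
  have h1 := hc.class_of_pow_ne_zero k (ne_of_gt hk)
  have h2 : (c e : ℕ) + k ≡ c e + 0 [MOD h] := by
    rw [add_zero, Nat.ModEq, ← h1, Nat.mod_eq_of_lt (c e).2]
  exact (Nat.modEq_zero_iff_dvd).mp (Nat.ModEq.add_left_cancel' _ h2)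

/-- Inside a class, all sufficiently high powers of `K ^ h` are positive. -/
theorem eventually_pow_apply_pos {K : Matrix n n ℝ} (hK : K.IsIrreducible) {h : ℕ}
    (hh : IsImprimitivityIndex K h) {c : n → Fin h} (hc : IsCyclicPartition K c) {e f : n}
    (hef : c e = c f) : ∀ᶠ m in atTop, 0 < (K ^ (h * m)) e f := by
  have hh0 : 0 < h := hh.1.1
  obtain ⟨k, hk, hk'⟩ := (isIrreducible_iff_exists_pow_pos hK.nonneg).mp hK e f
  have hdvd : h ∣ k := by
    have h1 := hc.class_of_pow_ne_zero k hk'.ne'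
    have h2 : (c e : ℕ) + k ≡ c e + 0 [MOD h] := by
      rw [add_zero, Nat.ModEq, ← h1, hef, Nat.mod_eq_of_lt (c f).2]
    exact (Nat.modEq_zero_iff_dvd).mp (Nat.ModEq.add_left_cancel' _ h2)
  obtain ⟨l, rfl⟩ := hdvd
  -- All large multiples of the gcd lie in the additive monoid generated by the return times, and
  -- return times are closed under addition.
  obtain ⟨N, hN⟩ := Nat.exists_mem_closure_of_ge (returnTimes K e)
  have hret : ∀ m ≥ N, h ∣ m → 0 < (K ^ m) e e := by
    intro m hm hdm
    rw [← hh.eq_setGcd hK e] at hdm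
    refine AddSubmonoid.closure_induction (motive := fun m _ ↦ 0 < (K ^ m) e e)
      (fun _ hx ↦ hx) (by simp) (fun _ _ _ _ hx hy ↦ pow_add_apply_pos hK.nonneg hx hy)
      (hN m hm hdm)
  filter_upwards [eventually_ge_atTop (N + l)] with m hm
  have hm' : h * m = h * (m - l) + h * l := by
    rw [← mul_add, Nat.sub_add_cancel (by omega)]
  rw [hm']
  refine pow_add_apply_pos hK.nonneg (hret _ ?_ (dvd_mul_right _ _)) hk'
  calc N ≤ m - l := by omega
    _ ≤ h * (m - l) := Nat.le_mul_of_pos_left _ hh0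

/-- Restricting the intermediate indices loses nothing: a walk starting in class a is in class a + i
after i steps, with no wrap-around before the last step. The final class `b` is left free so that b
= 0 covers a + k = h. -/
theorem blockProd_apply {K : Matrix n n ℝ} {h : ℕ} {c : n → Fin h} (hc : IsCyclicPartition K c)
    {a : ℕ} (k : ℕ) (hk : a + k ≤ h) {b : ℕ} (e : Cls c a) (f : Cls c b) :
    blockProd K c a k b e f = (K ^ k) e f := by
  induction k generalizing b with
  | zero => simp [blockProd, block]
  | succ k ih =>
    rw [blockProd, mul_apply, pow_succ, mul_apply]
    rw [← sum_cls_eq c (a := a + k) (F := fun g ↦ (K ^ k) e g * K g f)]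
    · refine Finset.sum_congr rfl fun g _ ↦ ?_
      rw [ih (by omega)]
      rfl
    · intro g hg
      rw [hc.class_of_pow_ne_zero k (left_ne_zero_of_mul hg), e.2, Nat.mod_eq_of_lt (by omega)]

theorem cycleProd_apply {K : Matrix n n ℝ} {h : ℕ} {c : n → Fin h} (hc : IsCyclicPartition K c)
    (e f : Cls c 0) : cycleProd K c e f = (K ^ h) e f :=
  blockProd_apply hc h (zero_add h).le e f

theorem cycleProd_pow_apply {K : Matrix n n ℝ} {h : ℕ} {c : n → Fin h}
    (hc : IsCyclicPartition K c) (m : ℕ) (e f : Cls c 0) :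
    (cycleProd K c ^ m) e f = (K ^ (h * m)) e f := by
  induction m generalizing f with
  | zero => simp [one_apply, Subtype.ext_iff]
  | succ m ih =>
    rw [pow_succ, mul_apply, mul_add, mul_one, pow_add, mul_apply]
    rw [← sum_cls_eq c (a := 0) (F := fun g ↦ (K ^ (h * m)) e g * (K ^ h) g f)]
    · exact Finset.sum_congr rfl fun g _ ↦ by rw [ih, cycleProd_apply hc]
    · intro g hg
      rw [hc.class_of_pow_ne_zero _ (left_ne_zero_of_mul hg), e.2, zero_add, Nat.mul_mod_right]

theorem cycleProd_mulVec {K : Matrix n n ℝ} {h : ℕ} {c : n → Fin h}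
    (hc : IsCyclicPartition K c) {w : n → ℝ} {ρ : ℝ} (hw : K *ᵥ w = ρ • w) :
    (cycleProd K c *ᵥ fun e ↦ w e) = ρ ^ h • fun e : Cls c 0 ↦ w e := by
  ext e
  have h1 := congrFun (pow_mulVec_eq hw h) e
  simp only [mulVec, dotProduct, Pi.smul_apply] at h1 ⊢
  rw [← h1, ← sum_cls_eq c (a := 0) (F := fun g ↦ (K ^ h) e g * w g)]
  · exact Finset.sum_congr rfl fun g _ ↦ by rw [cycleProd_apply hc]
  · intro g hg
    rw [hc.class_of_pow_ne_zero _ (left_ne_zero_of_mul hg), e.2, zero_add, Nat.mod_self]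

theorem cycleProd_nonneg {K : Matrix n n ℝ} (hK : ∀ i j, 0 ≤ K i j) {h : ℕ} {c : n → Fin h}
    (hc : IsCyclicPartition K c) (e f : Cls c 0) : 0 ≤ cycleProd K c e f := by
  rw [cycleProd_apply hc]; exact pow_apply_nonneg hK h _ _

theorem tendsto_cycleProd_pow {K : Matrix n n ℝ} (hK : K.IsIrreducible) (hρ : 0 < perronRoot K)
    {h : ℕ} (hh : IsImprimitivityIndex K h) {c : n → Fin h} (hc : IsCyclicPartition K c)
    {y z : Cls c 0 → ℝ} (hyz : IsPerronPair (cycleProd K c) y z) (e f : Cls c 0) :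
    Tendsto (fun m ↦ (perronRoot K ^ (h * m))⁻¹ * (cycleProd K c ^ m) e f) atTop
      (𝓝 (z e * y f)) := by
  have := nonempty_cls hc hh.1.1
  have : Nonempty n := ⟨e⟩
  obtain ⟨w, hw, hKw⟩ := exists_pos_eigenvector hK
  have hA := cycleProd_nonneg hK.nonneg hc
  have hAw := cycleProd_mulVec hc hKw
  have hroot : perronRoot (cycleProd K c) = perronRoot K ^ h :=
    perronRoot_eq_of_pos_eigenvector hA (fun i ↦ hw i) hAw
  have hev : ∀ᶠ m in atTop, ∀ i j, 0 < (cycleProd K c ^ m) i j := by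
    simp only [eventually_all, cycleProd_pow_apply hc]
    exact fun i j ↦ eventually_pow_apply_pos hK hh hc (Fin.ext (i.2.trans j.2.symm))
  obtain ⟨N, hN, hN0⟩ := (hev.and (eventually_gt_atTop 0)).exists
  have hlim := hyz.tendsto_pow hA (fun i ↦ hw i) (hroot ▸ hAw) (hroot ▸ pow_pos hρ h) hN0 hN e f
  simpa only [hroot, ← pow_mul] using hlim

end Cyclic

/-! ### Scaled partial sums of sequences that are periodic up to a geometric factor -/

section ScaledSums

theorem sum_range_mul_add {h r : ℕ} {ρ : ℝ} {W : ℕ → ℝ} (hW : ∀ i, W (i + h) = ρ ^ h * W i)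
    (q : ℕ) : ∑ i ∈ Finset.range (h * q + r), W i =
      ∑ i ∈ Finset.range r, W i +
        (∑ m ∈ Finset.range q, (ρ ^ h) ^ m) * ∑ s ∈ Finset.range h, W (r + s) := by
  have hW' : ∀ i m, W (i + h * m) = (ρ ^ h) ^ m * W i := by
    intro i m
    induction m with
    | zero => simp
    | succ m ih => rw [mul_add, mul_one, ← add_assoc, hW, ih, pow_succ']; ring
  induction q with
  | zero => simp
  | succ q ih =>
    have h1 : h * (q + 1) + r = (h * q + r) + h := by ring
    rw [h1, Finset.sum_range_add, ih, Finset.sum_range_succ (fun m ↦ (ρ ^ h) ^ m), add_mul,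
      Finset.mul_sum (Finset.range h) _ ((ρ ^ h) ^ q), add_assoc, add_right_inj, add_right_inj]
    refine Finset.sum_congr rfl fun s _ ↦ ?_
    rw [← hW']
    congr 1
    ring

/-- After the first r terms the sum consists of q blocks, whose geometric factor exactly cancels the
prefactor; the prefactor sends the first r terms to 0. -/
theorem tendsto_scaled_sum {h r : ℕ} (hh : 0 < h) {ρ : ℝ} (hρ : 1 < ρ) {W : ℕ → ℝ}
    (hW : ∀ i, W (i + h) = ρ ^ h * W i) :
    Tendsto (fun q : ℕ ↦ (ρ ^ h - 1) / (ρ ^ (h * q) - 1) *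
      ∑ i ∈ Finset.range (h * q + r), W i) atTop (𝓝 (∑ s ∈ Finset.range h, W (r + s))) := by
  have hρh : 1 < ρ ^ h := one_lt_pow₀ hρ hh.ne'
  have hlim : Tendsto (fun q : ℕ ↦ (ρ ^ h - 1) / ((ρ ^ h) ^ q - 1)) atTop (𝓝 0) :=
    ((tendsto_pow_atTop_atTop_of_one_lt hρh).atTop_add
      (tendsto_const_nhds (x := (-1 : ℝ)))).const_div_atTop _
  have hlim2 := (hlim.mul_const (∑ i ∈ Finset.range r, W i)).add_const
    (∑ s ∈ Finset.range h, W (r + s))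
  rw [zero_mul, zero_add] at hlim2
  refine hlim2.congr' ?_
  filter_upwards [eventually_gt_atTop 0] with q hq
  have h1 : (ρ ^ h) ^ q - 1 ≠ 0 := (sub_pos.mpr (one_lt_pow₀ hρh hq.ne')).ne'
  have h2 : ρ ^ h - 1 ≠ 0 := (sub_pos.mpr hρh).ne'
  rw [sum_range_mul_add hW, geom_sum_eq hρh.ne', pow_mul]
  field_simp

theorem tendsto_scaled_sum_of_asymptotic {h r : ℕ} (hh : 0 < h) {ρ : ℝ} (hρ : 1 < ρ)
    {W a : ℕ → ℝ} (hW : ∀ i, W (i + h) = ρ ^ h * W i)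
    (ha : Tendsto (fun i ↦ (ρ ^ i)⁻¹ * (a i - W i)) atTop (𝓝 0)) :
    Tendsto (fun q : ℕ ↦ (ρ ^ h - 1) / (ρ ^ (h * q) - 1) *
      ∑ i ∈ Finset.range (h * q + r), a i) atTop (𝓝 (∑ s ∈ Finset.range h, W (r + s))) := by
  have hρ0 : 0 < ρ := one_pos.trans hρ
  have hsum : ∀ N, ∑ i ∈ Finset.range N, ρ ^ i = (ρ ^ N - 1) / (ρ - 1) := geom_sum_eq hρ.ne'
  have hdiv : Tendsto (fun N ↦ ∑ i ∈ Finset.range N, ρ ^ i) atTop atTop := by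
    simp only [hsum]
    exact ((tendsto_pow_atTop_atTop_of_one_lt hρ).atTop_add
      (tendsto_const_nhds (x := (-1 : ℝ)))).atTop_div_const (sub_pos.mpr hρ)
  have hlittle : (fun i ↦ a i - W i) =o[atTop] fun i ↦ ρ ^ i := by
    rw [Asymptotics.isLittleO_iff_tendsto' (.of_forall fun i hi ↦ absurd hi (pow_pos hρ0 i).ne')]
    exact ha.congr fun i ↦ by rw [div_eq_inv_mul]
  have hratio := (hlittle.sum_range (fun i ↦ (pow_pos hρ0 i).le) hdiv).tendsto_div_nhds_zero
  have hN : Tendsto (fun q : ℕ ↦ h * q + r) atTop atTop :=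
    tendsto_atTop_mono (fun q ↦ (Nat.le_mul_of_pos_left q hh).trans (Nat.le_add_right _ _))
      tendsto_id
  have h1 := tendsto_scaled_sum (r := r) hh hρ hW
  -- The scaled sums of ρ^i converge, so a sum that is o(∑ ρ^i) disappears after scaling.
  have h2 := tendsto_scaled_sum (r := r) hh hρ (W := fun i ↦ ρ ^ i)
    (fun i ↦ by rw [pow_add, mul_comm])
  have h3 := h1.add (h2.mul (hratio.comp hN))
  rw [mul_zero, add_zero] at h3
  refine h3.congr' ?_
  filter_upwards [hN.eventually (eventually_gt_atTop 0)] with q hq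
  have hpos : (∑ i ∈ Finset.range (h * q + r), ρ ^ i) ≠ 0 :=
    (Finset.sum_pos (fun i _ ↦ pow_pos hρ0 i) (Finset.nonempty_range_iff.mpr hq.ne')).ne'
  simp only [Function.comp_apply, Finset.sum_sub_distrib]
  field_simp
  ring

end ScaledSums

/-! ### The circulant matrix as a polynomial in the cyclic permutation -/

section Circulant

theorem matP_pow_apply {h : ℕ} (k : ℕ) (i j : Fin h) :
    (matP h ^ k) i j = if (j : ℕ) = (i + k) % h then 1 else 0 := by
  induction k generalizing j with
  | zero =>
    rw [pow_zero, one_apply, add_zero, Nat.mod_eq_of_lt i.2]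
    simp [Fin.ext_iff, eq_comm]
  | succ k ih =>
    have hh : 0 < h := i.pos
    rw [pow_succ, mul_apply,
      Finset.sum_eq_single (⟨(i + k) % h, Nat.mod_lt _ hh⟩ : Fin h)]
    · rw [ih]
      simp [matP, add_assoc]
    · intro g _ hg
      rw [ih, if_neg fun h1 ↦ hg (Fin.ext h1), zero_mul]
    · simp

theorem matTheta_eq_sum (ρ : ℝ) (h : ℕ) :
    matTheta ρ h = ∑ s ∈ Finset.range h, ρ ^ s • matP h ^ s := by
  ext i j
  have hh : 0 < h := i.pos
  have hi := i.2
  have hj := j.2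
  have hiff : ∀ s < h, (j : ℕ) = (i + s) % h ↔ s = (j + (h - i)) % h := by
    intro s hs
    rcases lt_or_ge (i + s : ℕ) h with h1 | h1 <;> rcases lt_or_ge (j + (h - i) : ℕ) h with h2 | h2
    · rw [Nat.mod_eq_of_lt h1, Nat.mod_eq_of_lt h2]; omega
    · rw [Nat.mod_eq_of_lt h1, Nat.mod_eq_sub_mod h2, Nat.mod_eq_of_lt (by omega)]; omega
    · rw [Nat.mod_eq_sub_mod h1, Nat.mod_eq_of_lt (by omega), Nat.mod_eq_of_lt h2]; omega
    · rw [Nat.mod_eq_sub_mod h1, Nat.mod_eq_of_lt (by omega), Nat.mod_eq_sub_mod h2,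
        Nat.mod_eq_of_lt (by omega)]; omega
  rw [Matrix.sum_apply, Finset.sum_eq_single ((j + (h - i)) % h : ℕ)]
  · rw [Matrix.smul_apply, matP_pow_apply, if_pos ((hiff _ (Nat.mod_lt _ hh)).mpr rfl)]
    simp [matTheta]
  · intro s hs hne
    rw [Matrix.smul_apply, matP_pow_apply, if_neg, smul_zero]
    exact fun h1 ↦ hne ((hiff s (Finset.mem_range.mp hs)).mp h1)
  · exact fun h1 ↦ absurd (Finset.mem_range.mpr (Nat.mod_lt _ hh)) h1

end Circulant

/-! ### Asymptotics of the powers of `K` and the limit formula -/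

section Limit

variable {n : Type*} [Fintype n] [DecidableEq n]

theorem matZ_mul_matP_pow_mul_matY_apply (K : Matrix n n ℝ) {h : ℕ} (c : n → Fin h)
    (y z : Cls c 0 → ℝ) (k : ℕ) (e f : n) :
    (matZ K c z * matP h ^ k * matY K c y) e f =
      if (c f : ℕ) = (c e + k) % h then
        rightVec K c z (c e) ⟨e, rfl⟩ * leftVec K c y (c f) ⟨f, rfl⟩ else 0 := by
  rw [mul_apply, Finset.sum_eq_single (c f), mul_apply, Finset.sum_eq_single (c e),
    matP_pow_apply]
  · simp [matZ, matY]
  · intro j _ hj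
    rw [matZ, of_apply, dif_neg fun h1 : (c e : ℕ) = j ↦ hj (Fin.ext h1.symm), zero_mul]
  · simp
  · intro j _ hj
    rw [matY, of_apply, dif_neg fun h1 : (c f : ℕ) = j ↦ hj (Fin.ext h1.symm), mul_zero]
  · simp

theorem rightVec_apply {K : Matrix n n ℝ} {h : ℕ} {c : n → Fin h} (hc : IsCyclicPartition K c)
    {z : Cls c 0 → ℝ} {j : ℕ} (hj : j ≤ h) (e : Cls c j) :
    rightVec K c z j e = (perronRoot K ^ (h - j))⁻¹ * ∑ g : Cls c 0, (K ^ (h - j)) e g * z g := by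
  simp only [rightVec, Pi.smul_apply, smul_eq_mul, mulVec, dotProduct,
    blockProd_apply hc (h - j) (Nat.add_sub_cancel' hj).le]

theorem leftVec_apply {K : Matrix n n ℝ} {h : ℕ} {c : n → Fin h} (hc : IsCyclicPartition K c)
    {y : Cls c 0 → ℝ} {j : ℕ} (hj : j ≤ h) (e : Cls c j) :
    leftVec K c y j e = (perronRoot K ^ j)⁻¹ * ∑ g : Cls c 0, y g * (K ^ j) g e := by
  simp only [leftVec, Pi.smul_apply, smul_eq_mul, vecMul, dotProduct,
    blockProd_apply hc j (zero_add j ▸ hj)]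

/-- Every such walk visits class 0 after h − c(e) steps and again h m steps later. For e in class 0
the first stretch is a whole circuit, in agreement with `rightVec` at j = 0. -/
theorem pow_apply_eq_sum_cycleProd {K : Matrix n n ℝ} {h : ℕ} {c : n → Fin h}
    (hc : IsCyclicPartition K c) (m : ℕ) (e f : n) :
    (K ^ (h - c e + h * m + c f)) e f = ∑ g : Cls c 0, ∑ g' : Cls c 0,
      (K ^ (h - c e : ℕ)) e g * (cycleProd K c ^ m) g g' * (K ^ (c f : ℕ)) g' f := by
  have hstep : ∀ g, (K ^ (h - c e : ℕ)) e g ≠ 0 → (c g : ℕ) = 0 := fun g hg ↦ by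
    rw [hc.class_of_pow_ne_zero _ hg, Nat.add_sub_cancel' (c e).2.le, Nat.mod_self]
  rw [add_assoc, pow_add, mul_apply, ← sum_cls_eq c (a := 0)
    (F := fun g ↦ (K ^ (h - c e : ℕ)) e g * (K ^ (h * m + c f)) g f)
    fun g hg ↦ hstep g (left_ne_zero_of_mul hg)]
  refine Finset.sum_congr rfl fun g _ ↦ ?_
  rw [pow_add, mul_apply, ← sum_cls_eq c (a := 0)
    (F := fun g' ↦ (K ^ (h * m)) g g' * (K ^ (c f : ℕ)) g' f), Finset.mul_sum]
  · exact Finset.sum_congr rfl fun g' _ ↦ by rw [cycleProd_pow_apply hc, mul_assoc]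
  · intro g' hg'
    rw [hc.class_of_pow_ne_zero _ (left_ne_zero_of_mul hg'), g.2, zero_add, Nat.mul_mod_right]

theorem tendsto_pow_along_class {K : Matrix n n ℝ} (hK : K.IsIrreducible)
    (hρ : 0 < perronRoot K) {h : ℕ} (hh : IsImprimitivityIndex K h) {c : n → Fin h}
    (hc : IsCyclicPartition K c) {y z : Cls c 0 → ℝ} (hyz : IsPerronPair (cycleProd K c) y z)
    (e f : n) :
    Tendsto (fun m ↦ (perronRoot K ^ (h - c e + h * m + c f))⁻¹ *
        (K ^ (h - c e + h * m + c f)) e f) atTop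
      (𝓝 (rightVec K c z (c e) ⟨e, rfl⟩ * leftVec K c y (c f) ⟨f, rfl⟩)) := by
  have hlim : Tendsto (fun m ↦ ∑ g : Cls c 0, ∑ g' : Cls c 0,
      (perronRoot K ^ (h - c e : ℕ))⁻¹ * (K ^ (h - c e : ℕ)) e g *
        ((perronRoot K ^ (h * m))⁻¹ * (cycleProd K c ^ m) g g') *
        ((perronRoot K ^ (c f : ℕ))⁻¹ * (K ^ (c f : ℕ)) g' f)) atTop
      (𝓝 (∑ g : Cls c 0, ∑ g' : Cls c 0,
        (perronRoot K ^ (h - c e : ℕ))⁻¹ * (K ^ (h - c e : ℕ)) e g * (z g * y g') *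
        ((perronRoot K ^ (c f : ℕ))⁻¹ * (K ^ (c f : ℕ)) g' f))) :=
    tendsto_finsetSum _ fun g _ ↦ tendsto_finsetSum _ fun g' _ ↦
      ((tendsto_cycleProd_pow hK hρ hh hc hyz g g').const_mul _).mul_const _
  convert! hlim using 2
  · rename_i m
    rw [pow_apply_eq_sum_cycleProd hc, pow_add, pow_add, mul_inv, mul_inv, Finset.mul_sum]
    refine Finset.sum_congr rfl fun g _ ↦ ?_
    rw [Finset.mul_sum]
    exact Finset.sum_congr rfl fun g' _ ↦ by ring
  · rw [rightVec_apply hc (c e).2.le, leftVec_apply hc (c f).2.le, Finset.mul_sum,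
      Finset.mul_sum, Finset.sum_mul]
    refine Finset.sum_congr rfl fun g _ ↦ ?_
    rw [Finset.mul_sum]
    exact Finset.sum_congr rfl fun g' _ ↦ by ring

theorem tendsto_pow_sub {K : Matrix n n ℝ} (hK : K.IsIrreducible)
    (hρ : 0 < perronRoot K) {h : ℕ} (hh : IsImprimitivityIndex K h) {c : n → Fin h}
    (hc : IsCyclicPartition K c) {y z : Cls c 0 → ℝ} (hyz : IsPerronPair (cycleProd K c) y z)
    (e f : n) :
    Tendsto (fun i ↦ (perronRoot K ^ i)⁻¹ * ((K ^ i) e f -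
        perronRoot K ^ i * (matZ K c z * matP h ^ i * matY K c y) e f)) atTop (𝓝 0) := by
  have hh0 : 0 < h := hh.1.1
  have hlim := tendsto_pow_along_class hK hρ hh hc hyz e f
  set v := rightVec K c z (c e) ⟨e, rfl⟩ * leftVec K c y (c f) ⟨f, rfl⟩
  -- This is the number of full circuits in a walk of length i from `e` to `f`, when one is
  -- possible. For i in any other residue class both terms of the difference vanish.
  have hm : Tendsto (fun i ↦ (i - (h - c e) - c f) / h) atTop atTop :=
    (Nat.tendsto_div_const_atTop hh0.ne').comp
      ((tendsto_sub_atTop_nat _).comp (tendsto_sub_atTop_nat _))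
  have hlim' := (tendsto_sub_nhds_zero_iff.mpr hlim).comp hm
  refine squeeze_zero_norm' ?_ (tendsto_zero_iff_norm_tendsto_zero.mp hlim')
  -- From 2h on, the truncated subtractions are genuine.
  filter_upwards [eventually_ge_atTop (h + h)] with i hi
  rw [matZ_mul_matP_pow_mul_matY_apply, mul_sub, ← mul_assoc,
    inv_mul_cancel₀ (pow_pos hρ i).ne', one_mul]
  split_ifs with hcls
  · have he := (c e).2
    have hf := (c f).2
    have hdvd : h ∣ i - (h - c e) - c f := by
      refine (Nat.modEq_iff_dvd' (by omega)).mp ?_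
      have h1 : (c f : ℕ) + (h - c e) ≡ i + c e + (h - c e) [MOD h] := by
        refine Nat.ModEq.add_right _ ?_
        rw [Nat.ModEq, hcls, Nat.mod_mod, add_comm]
      refine Nat.ModEq.add_right_cancel' (h - c e) (h1.trans ?_)
      have h2 : i + c e + (h - c e) = i - (h - c e) + (h - c e) + h := by omega
      rw [h2]
      simp [Nat.ModEq]
    have hi' : h - c e + h * ((i - (h - c e) - c f) / h) + c f = i := by
      rw [Nat.mul_div_cancel' hdvd]; omega
    simp only [Function.comp_apply, hi']
    exact le_rfl
  · have h0 : (K ^ i) e f = 0 := by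
      by_contra hne
      exact hcls (hc.class_of_pow_ne_zero i hne)
    simp [h0]

theorem tendsto_smul_sum_pow {K : Matrix n n ℝ} (hK : K.IsIrreducible)
    (hρ : 1 < perronRoot K) {h : ℕ} (hh : IsImprimitivityIndex K h) {c : n → Fin h}
    (hc : IsCyclicPartition K c) {y z : Cls c 0 → ℝ} (hyz : IsPerronPair (cycleProd K c) y z)
    (r : ℕ) :
    Tendsto (fun q : ℕ ↦ ((perronRoot K ^ h - 1) / (perronRoot K ^ (h * q) - 1)) •
        ∑ i ∈ Finset.range (h * q + r), K ^ i) atTop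
      (𝓝 (perronRoot K ^ r •
        (matZ K c z * matP h ^ r * matTheta (perronRoot K) h * matY K c y))) := by
  refine tendsto_pi_nhds.mpr fun e ↦ tendsto_pi_nhds.mpr fun f ↦ ?_
  have hP : ∀ i, matP h ^ (i + h) = matP h ^ i := by
    intro i
    ext a b
    rw [matP_pow_apply, matP_pow_apply, ← add_assoc, Nat.add_mod_right]
  have hlim := tendsto_scaled_sum_of_asymptotic (r := r) (a := fun i ↦ (K ^ i) e f) hh.1.1 hρ
    (W := fun i ↦ perronRoot K ^ i * (matZ K c z * matP h ^ i * matY K c y) e f)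
    (fun i ↦ by simp only [hP, pow_add]; ring)
    (tendsto_pow_sub hK (one_pos.trans hρ) hh hc hyz e f)
  convert! hlim using 2
  · rw [Matrix.smul_apply, Matrix.sum_apply, smul_eq_mul]
  · rw [matTheta_eq_sum, Matrix.mul_sum, Matrix.sum_mul, Finset.smul_sum, Matrix.sum_apply]
    refine Finset.sum_congr rfl fun s _ ↦ ?_
    rw [pow_add, pow_add, Matrix.mul_smul, Matrix.smul_mul, smul_smul, Matrix.smul_apply, smul_eq_mul,
      ← Matrix.mul_assoc (matZ K c z)]

end Limit

/-! ### Non-backtracking walks and symmetry of reachability -/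

/-- A set of states closed under the steps of a doubly stochastic matrix is also closed under
the reversed steps. -/
theorem mem_of_doublyStochastic {E : Type*} [Fintype E] {P : E → E → ℚ}
    (hP : ∀ e f, 0 ≤ P e f) (hrow : ∀ e, ∑ f, P e f = 1) (hcol : ∀ f, ∑ e, P e f = 1)
    {S : Set E} (hS : ∀ e f, e ∈ S → P e f ≠ 0 → f ∈ S) {e f : E} (hf : f ∈ S)
    (hef : P e f ≠ 0) : e ∈ S := by
  classical
  by_contra he
  -- Summed by rows, the mass inside S × S is |S|; summed by columns it is smaller, since column `f`
  -- also receives mass from `e` outside `S`.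
  have h1 : ∑ e' with e' ∈ S, ∑ f' with f' ∈ S, P e' f' = ∑ e' with e' ∈ S, (1 : ℚ) := by
    refine Finset.sum_congr rfl fun e' he' ↦ ?_
    rw [← hrow e']
    exact Finset.sum_filter_of_ne fun f' _ hne ↦ hS e' f' (Finset.mem_filter.mp he').2 hne
  have h2 : ∑ f' with f' ∈ S, ∑ e' with e' ∈ S, P e' f' < ∑ f' with f' ∈ S, (1 : ℚ) := by
    refine Finset.sum_lt_sum (fun f' _ ↦ ?_) ⟨f, by simpa using hf, ?_⟩
    · rw [← hcol f']
      exact Finset.sum_le_sum_of_subset_of_nonneg (Finset.filter_subset _ _)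
        fun _ _ _ ↦ hP _ _
    · rw [← hcol f]
      exact Finset.sum_lt_sum_of_subset (Finset.filter_subset _ _) (Finset.mem_univ e)
        (by simpa using he) ((hP e f).lt_of_ne' hef) fun _ _ _ ↦ hP _ _
  rw [Finset.sum_comm, h1] at h2
  exact lt_irrefl _ h2

section NonBacktracking

variable {E L : Type*} [Fintype E] {left : E → L} {bar : E → E}

open Classical in
/-- The elements other than `e` in the fibre of `e`. -/
noncomputable def siblings (left : E → L) (e : E) : Finset E := {g | left g = left e ∧ g ≠ e}

@[simp] theorem mem_siblings {e g : E} : g ∈ siblings left e ↔ left g = left e ∧ g ≠ e := by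
  simp [siblings]

theorem mem_siblings_comm {e g : E} : g ∈ siblings left e ↔ e ∈ siblings left g := by
  simp only [mem_siblings, eq_comm, ne_comm]

open Classical in
theorem card_siblings_add_one (e : E) :
    (siblings left e).card + 1 = Nat.card {g : E // left g = left e} := by
  rw [Nat.card_eq_fintype_card, Fintype.card_subtype]
  have h : siblings left e = (Finset.univ.filter fun g ↦ left g = left e).erase e := by
    ext g; simp [and_comm]
  rw [h, Finset.card_erase_add_one (by simp)]

theorem card_siblings_congr {e f : E} (h : left e = left f) :
    (siblings left e).card = (siblings left f).card := by
  have h1 := card_siblings_add_one (left := left) e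
  rw [h, ← card_siblings_add_one] at h1
  exact Nat.succ_injective h1

/-- Steps of a walk that never turns back: leave `e` along a sibling, arrive at its conjugate. -/
def Step (left : E → L) (bar : E → E) (e f : E) : Prop := bar f ∈ siblings left e

theorem step_bar (hbar : Function.Involutive bar) {e g : E} (hg : g ∈ siblings left e) :
    Step left bar e (bar g) := by
  rw [Step, hbar g]; exact hg

/-- Choosing a sibling uniformly makes the steps doubly stochastic: siblinghood is symmetric, fibre
sizes are constant along it, and `bar` is a bijection. The set reachable from the end of a step is
therefore closed under reversed steps and contains the start. -/
theorem reflTransGen_step_symm (hbar : Function.Involutive bar)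
    (hsib : ∀ e, (siblings left e).Nonempty) {e f : E}
    (h : Relation.ReflTransGen (Step left bar) e f) :
    Relation.ReflTransGen (Step left bar) f e := by
  classical
  have hcard : ∀ e, ((siblings left e).card : ℚ) ≠ 0 := fun e ↦ by
    simpa using (hsib e).ne_empty
  induction h with
  | refl => exact .refl
  | @tail f g _ hfg ih =>
    refine Relation.ReflTransGen.trans ?_ ih
    refine mem_of_doublyStochastic
      (P := fun e f ↦ if bar f ∈ siblings left e then ((siblings left e).card : ℚ)⁻¹ else 0)
      (fun e f ↦ by positivity) (fun e ↦ ?_) (fun f ↦ ?_)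
      (S := {x | Relation.ReflTransGen (Step left bar) g x}) (fun x y hx hxy ↦ ?_)
      (f := g) .refl ?_
    · rw [hbar.bijective.sum_comp
        (fun g ↦ if g ∈ siblings left e then ((siblings left e).card : ℚ)⁻¹ else 0)]
      rw [Finset.sum_ite_mem, Finset.univ_inter, Finset.sum_const, nsmul_eq_mul,
        mul_inv_cancel₀ (hcard e)]
    · calc ∑ e, (if bar f ∈ siblings left e then ((siblings left e).card : ℚ)⁻¹ else 0)
          = ∑ e, if e ∈ siblings left (bar f) then
              ((siblings left (bar f)).card : ℚ)⁻¹ else 0 := by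
            refine Finset.sum_congr rfl fun e _ ↦ ?_
            by_cases h : bar f ∈ siblings left e
            · rw [if_pos h, if_pos (mem_siblings_comm.mp h),
                card_siblings_congr (mem_siblings.mp h).1]
            · rw [if_neg h, if_neg (mt mem_siblings_comm.mpr h)]
        _ = 1 := by
            rw [Finset.sum_ite_mem, Finset.univ_inter, Finset.sum_const, nsmul_eq_mul,
              mul_inv_cancel₀ (hcard _)]
    · exact Relation.ReflTransGen.tail hx (by by_contra hn; exact hxy (if_neg hn))
    · rw [if_pos (show bar g ∈ siblings left f from hfg)]; exact inv_ne_zero (hcard f)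

/-- The elements that can be reached from `a` together with their conjugates are closed under
passing to siblings. -/
theorem reflTransGen_step_of_sibling (hbar : Function.Involutive bar)
    (hsib : ∀ e, (siblings left e).Nonempty) {a e g : E}
    (he : Relation.ReflTransGen (Step left bar) a e)
    (he' : Relation.ReflTransGen (Step left bar) a (bar e)) (hg : g ∈ siblings left e) :
    Relation.ReflTransGen (Step left bar) a g ∧
      Relation.ReflTransGen (Step left bar) a (bar g) :=
  -- There are steps from `e` to `bar g` and from `g` to `bar e`; the second is used in reverse.
  ⟨he'.trans (reflTransGen_step_symm hbar hsib
    (.single (step_bar hbar (mem_siblings_comm.mp hg)))), he.tail (step_bar hbar hg)⟩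

/-- With two siblings g and k of `a`, both `a` and k step to `bar g`, so `a` reaches k by symmetry,
and k steps to `bar a`: the walk has turned round. -/
theorem reflTransGen_step_bar_of_two_lt (hbar : Function.Involutive bar)
    (hsib : ∀ e, (siblings left e).Nonempty) {a : E} (ha : 1 < (siblings left a).card) :
    Relation.ReflTransGen (Step left bar) a (bar a) := by
  obtain ⟨g, hg, k, hk, hgk⟩ := Finset.one_lt_card.mp ha
  have hkg : g ∈ siblings left k :=
    mem_siblings.mpr ⟨(mem_siblings.mp hg).1.trans (mem_siblings.mp hk).1.symm, hgk⟩
  have h1 : Relation.ReflTransGen (Step left bar) a k :=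
    (Relation.ReflTransGen.single (step_bar hbar hg)).trans
      (reflTransGen_step_symm hbar hsib (.single (step_bar hbar hkg)))
  exact h1.tail (step_bar hbar (mem_siblings_comm.mp hk))

end NonBacktracking

/-! ### Flow matrices: irreducibility and Perron root -/

namespace BipartiteGraph

variable {E L R : Type*} [Fintype E] (B : BipartiteGraph E L R)

omit [Fintype E] in
theorem exists_conj (hR : ∀ r, B.rightDegree r = 2) :
    ∃ bar : E → E, Function.Involutive bar ∧ ∀ f g, B.IsConj f g ↔ g = bar f := by
  have huniq : ∀ f, ∃ g, ∀ k, B.IsConj f k ↔ k = g := by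
    intro f
    obtain ⟨x, y, hxy, huniv⟩ := Nat.card_eq_two_iff.mp (hR (B.right f))
    have hall : ∀ k, B.right k = B.right f → k = x ∨ k = y := by
      intro k hk
      have : (⟨k, hk⟩ : {e // B.right e = B.right f}) ∈ ({x, y} : Set _) := huniv ▸ Set.mem_univ _
      simpa [Subtype.ext_iff] using this
    have hxy' : (x : E) ≠ y := fun h ↦ hxy (Subtype.ext h)
    rcases hall f rfl with hf | hf
    · refine ⟨y, fun k ↦ ⟨fun hk ↦ (hall k hk.2).resolve_left (hf ▸ hk.1), ?_⟩⟩
      rintro rfl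
      exact ⟨fun h ↦ hxy' (hf.symm.trans h.symm), y.2⟩
    · refine ⟨x, fun k ↦ ⟨fun hk ↦ (hall k hk.2).resolve_right (hf ▸ hk.1), ?_⟩⟩
      rintro rfl
      exact ⟨fun h ↦ hxy' (h.trans hf), x.2⟩
  choose bar hbar using huniq
  refine ⟨bar, fun f ↦ ?_, hbar⟩
  have h1 := (hbar f _).mpr rfl
  exact ((hbar (bar f) f).mp ⟨h1.1.symm, h1.2.symm⟩).symm

variable {B} {bar : E → E}

open Classical in
theorem flowMatrix_apply (hconj : ∀ f g, B.IsConj f g ↔ g = bar f) (e f : E) :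
    B.flowMatrix e f = if bar f ∈ siblings B.left e then 1 else 0 := by
  simp [flowMatrix, hconj]

theorem siblings_nonempty (hL : ∀ l, 2 ≤ B.leftDegree l) (e : E) :
    (siblings B.left e).Nonempty := by
  rw [← Finset.card_pos]
  have h1 : 2 ≤ Nat.card {g : E // B.left g = B.left e} := hL (B.left e)
  rw [← card_siblings_add_one] at h1
  omega

theorem exists_one_lt_card_siblings (hL : ∃ l, 3 ≤ B.leftDegree l) :
    ∃ a, ∀ e, B.left e = B.left a → 1 < (siblings B.left e).card := by
  obtain ⟨l, hl⟩ := hL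
  have hpos : 0 < Nat.card {e : E // B.left e = l} := (by norm_num : 0 < 3).trans_le hl
  obtain ⟨⟨a, rfl⟩⟩ := (Nat.card_pos_iff.mp hpos).1
  refine ⟨a, fun e he ↦ ?_⟩
  rw [card_siblings_congr he]
  have h1 := card_siblings_add_one (left := B.left) a
  have h2 : 3 ≤ Nat.card {g : E // B.left g = B.left a} := hl
  omega

/-- Any two edges are joined by a walk that never turns back. -/
theorem reflTransGen_step (hB : B.nodeGraph.Connected) (hbar : Function.Involutive bar)
    (hconj : ∀ f g, B.IsConj f g ↔ g = bar f) (hL : ∀ l, 2 ≤ B.leftDegree l)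
    (hL3 : ∃ l, 3 ≤ B.leftDegree l) (e f : E) :
    Relation.ReflTransGen (Step B.left bar) e f := by
  have hsib := siblings_nonempty hL
  obtain ⟨a, ha⟩ := exists_one_lt_card_siblings hL3
  -- Requiring both orientations to be reachable makes the property invariant under conjugation and
  -- under siblings, so it spreads through the connected node graph.
  set T : E → Prop := fun x ↦ Relation.ReflTransGen (Step B.left bar) a x ∧
    Relation.ReflTransGen (Step B.left bar) a (bar x)
  have hTbar : ∀ x, T x → T (bar x) := fun x hx ↦ ⟨hx.2, by rw [hbar x]; exact hx.1⟩
  have hTleft : ∀ x y, T x → B.left y = B.left x → T y := by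
    intro x y hx hxy
    by_cases hne : y = x
    · rwa [hne]
    · exact reflTransGen_step_of_sibling hbar hsib hx.1 hx.2 (mem_siblings.mpr ⟨hxy, hne⟩)
  have hTa : T a := ⟨.refl, reflTransGen_step_bar_of_two_lt hbar hsib (ha a rfl)⟩
  set X : L ⊕ R → Prop :=
    Sum.elim (fun l ↦ ∀ x, B.left x = l → T x) (fun r ↦ ∀ x, B.right x = r → T x)
  have hX : ∀ u v, B.nodeGraph.Adj u v → X u → X v := by
    intro u v huv hu
    rcases ((SimpleGraph.fromRel_adj _ _ _).mp huv).2 with ⟨x, rfl, rfl⟩ | ⟨x, rfl, rfl⟩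
    · have hx : T x := hu x rfl
      intro y hy
      by_cases hne : y = x
      · rwa [hne]
      · rw [(hconj x y).mp ⟨hne, hy⟩]; exact hTbar x hx
    · have hx : T x := hu x rfl
      exact fun y hy ↦ hTleft x y hx hy
  have hT : ∀ x, T x := by
    intro x
    have hreach := hB.preconnected (Sum.inl (B.left a)) (Sum.inl (B.left x))
    rw [SimpleGraph.reachable_iff_reflTransGen] at hreach
    have hXv : ∀ v, Relation.ReflTransGen B.nodeGraph.Adj (Sum.inl (B.left a)) v → X v := by
      intro v hv
      induction hv with
      | refl => exact fun y hy ↦ hTleft a y hTa hy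
      | tail _ huv ih => exact hX _ _ huv ih
    exact hXv _ hreach x rfl
  exact (reflTransGen_step_symm hbar hsib (hT e).1).trans (hT f).1

variable [DecidableEq E]

theorem flowMatrix_isIrreducible (hB : B.nodeGraph.Connected) (hR : ∀ r, B.rightDegree r = 2)
    (hL : ∀ l, 2 ≤ B.leftDegree l) (hL3 : ∃ l, 3 ≤ B.leftDegree l) :
    B.flowMatrix.IsIrreducible := by
  obtain ⟨bar, hbar, hconj⟩ := B.exists_conj hR
  have hnonneg : ∀ e f, 0 ≤ B.flowMatrix e f := fun e f ↦ by
    rw [flowMatrix_apply hconj]; split_ifs <;> norm_num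
  have hstep : ∀ {e f}, Step B.left bar e f → 0 < (B.flowMatrix ^ 1) e f := fun {e f} h ↦ by
    rw [pow_one, flowMatrix_apply hconj, if_pos (show bar f ∈ siblings B.left e from h)]
    exact one_pos
  rw [isIrreducible_iff_exists_pow_pos hnonneg]
  intro e f
  -- Irreducibility asks for a positive exponent even when e = f, so one step is taken first.
  obtain ⟨g, hg⟩ := siblings_nonempty hL e
  suffices h : ∃ k, 0 < (B.flowMatrix ^ k) (bar g) f by
    obtain ⟨k, hk⟩ := h
    exact ⟨1 + k, by omega, pow_add_apply_pos hnonneg (hstep (step_bar hbar hg)) hk⟩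
  have hreach := reflTransGen_step hB hbar hconj hL hL3 (bar g) f
  induction hreach with
  | refl => exact ⟨0, by simp⟩
  | tail _ hst ih =>
    obtain ⟨k, hk⟩ := ih
    exact ⟨k + 1, pow_add_apply_pos hnonneg hk (hstep hst)⟩

/-- Summing the coordinates of K w = ρ w for a positive `w` weights each w f with a column sum,
namely the left degree at the conjugate of f minus 1. This is at least 1 everywhere and more than 1
somewhere. -/
theorem one_lt_perronRoot_flowMatrix (hB : B.nodeGraph.Connected)
    (hR : ∀ r, B.rightDegree r = 2) (hL : ∀ l, 2 ≤ B.leftDegree l)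
    (hL3 : ∃ l, 3 ≤ B.leftDegree l) : 1 < perronRoot B.flowMatrix := by
  classical
  obtain ⟨bar, hbar, hconj⟩ := B.exists_conj hR
  obtain ⟨a, ha⟩ := exists_one_lt_card_siblings hL3
  have : Nonempty E := ⟨a⟩
  obtain ⟨w, hw, hKw⟩ := exists_pos_eigenvector (flowMatrix_isIrreducible hB hR hL hL3)
  have hcol : ∀ f, ∑ e, B.flowMatrix e f = (siblings B.left (bar f)).card := by
    intro f
    simp_rw [flowMatrix_apply hconj, mem_siblings_comm (g := bar f)]
    rw [Finset.sum_boole, Finset.filter_univ_mem]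
  have hsum : ∑ f, ((siblings B.left (bar f)).card : ℝ) * w f =
      perronRoot B.flowMatrix * ∑ e, w e := by
    have h1 : ∑ e, (B.flowMatrix *ᵥ w) e = ∑ e, (perronRoot B.flowMatrix • w) e := by rw [hKw]
    simp only [Pi.smul_apply, smul_eq_mul, ← Finset.mul_sum, mulVec, dotProduct] at h1
    rw [← h1, Finset.sum_comm]
    simp only [← Finset.sum_mul, hcol]
  have hlt : ∑ f, w f < ∑ f, ((siblings B.left (bar f)).card : ℝ) * w f := by
    refine Finset.sum_lt_sum (fun f _ ↦ ?_) ⟨bar a, Finset.mem_univ _, ?_⟩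
    · refine le_mul_of_one_le_left (hw f).le ?_
      exact_mod_cast (siblings_nonempty hL (bar f)).card_pos
    · refine lt_mul_of_one_lt_left (hw _) ?_
      rw [hbar a]
      exact_mod_cast ha a rfl
  rw [hsum] at hlt
  by_contra hle
  exact hlt.not_ge (mul_le_of_le_one_left (Finset.sum_nonneg fun e _ ↦ (hw e).le) (not_lt.mp hle))

end BipartiteGraph

end FlowLimit

theorem lemma4p2 :
    -- the limit formula for an irreducible nonnegative matrix with Perron root greater than `1`
    (∀ {n : Type*} [Fintype n] [DecidableEq n] (K : Matrix n n ℝ),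
      K.IsIrreducible → 1 < FlowLimit.perronRoot K →
      ∀ (h : ℕ), FlowLimit.IsImprimitivityIndex K h →
      ∀ (c : n → Fin h), FlowLimit.IsCyclicPartition K c →
      ∀ (y z : FlowLimit.Cls c 0 → ℝ),
        FlowLimit.IsPerronPair (FlowLimit.cycleProd K c) y z →
      ∀ (r : ℕ), r < h →
        Tendsto
          (fun q : ℕ =>
            ((FlowLimit.perronRoot K ^ h - 1) / (FlowLimit.perronRoot K ^ (h * q) - 1)) •
              ∑ i ∈ Finset.range (h * q + r), K ^ i)
          atTop
          (𝓝 (FlowLimit.perronRoot K ^ r •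
            (FlowLimit.matZ K c z * FlowLimit.matP h ^ r *
              FlowLimit.matTheta (FlowLimit.perronRoot K) h * FlowLimit.matY K c y)))) ∧
    -- every flow matrix is such a matrix
    (∀ {E L R : Type*} [Fintype E] [DecidableEq E] (B : FlowLimit.BipartiteGraph E L R),
      B.nodeGraph.Connected →
      (∀ r : R, B.rightDegree r = 2) →
      (∀ l : L, 2 ≤ B.leftDegree l) →
      (∃ l : L, 3 ≤ B.leftDegree l) →
        B.flowMatrix.IsIrreducible ∧ 1 < FlowLimit.perronRoot B.flowMatrix) := by
  refine ⟨?_, ?_⟩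
  · intro n _ _ K hK hρ h hh c hc y z hyz r _
    exact FlowLimit.tendsto_smul_sum_pow hK hρ hh hc hyz r
  · intro E L R _ _ B hB hR hL hL3
    exact ⟨FlowLimit.BipartiteGraph.flowMatrix_isIrreducible hB hR hL hL3,
      FlowLimit.BipartiteGraph.one_lt_perronRoot_flowMatrix hB hR hL hL3⟩
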